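/- Let $p_0,p_1$ be probability distributions on a measurable space $\mathcal X$ with finite Kullback–Leibler divergence $D(p_1\|p_0)<\infty$. For $N\ge 1$, an opportunistic detection rule (ODR) with maximum sample size $N$ consists of a stopping time $\tau$ with respect to the filtration generated by the samples $x_1,\dots,x_N\in\mathcal X$, with values in $\{1,\dots,N\}$, and a measurable terminal decision rule $D:\mathcal X^N\to\{\mathcal H_0,\mathcal H_1\}$; the decision is $\mathcal H_1$ if $\tau<N$ and $D(x_1,\dots,x_N)$ if $\tau=N$. With samples i.i.d. from $p_0$ under $\mathcal H_0$ and from $p_1$ under $\mathcal H_1$, put $$P_{\mathrm{FA}}=P_0\big(\{\tau<N\}\cup\{\tau=N,\,D=\mathcal H_1\}\big),\qquad P_{\mathrm M}=P_1(\tau=N,\,D=\mathcal H_0),\qquad T=\mathbb E_1[\tau].$$ Use natural logarithms, with $-\log 0=+\infty$. Fix a target miss probability $0<P_{\mathrm M}^\ast<1$ and $0\le\eta\le 1$. (Achievability) There exists a sequence of ODRs, indexed by the maximum sample size $N=1,2,\dots$, such that $P_{\mathrm M}\le P_{\mathrm M}^\ast$ for every $N$, $$\lim_{N\to\infty}\frac{T}{N}=\eta\qquad\text{and}\qquad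 \lim_{N\to\infty}\frac{-\log P_{\mathrm{FA}}}{N}=\eta\,D(p_1\|p_0).$$ (Converse) Every sequence of ODRs indexed by the maximum sample size $N$ with $P_{\mathrm M}\le P_{\mathrm M}^\ast$ for all sufficiently large $N$ and $\lim_{N\to\infty}T/N=\eta$ satisfies $$\liminf_{N\to\infty}\frac{-\log P_{\mathrm{FA}}}{N}\le \eta\,D(p_1\|p_0).$$ -/

import Mathlib

open MeasureTheory Filter Topology
open scoped ENNReal

/-- The filtration generated by the samples: at time `n` the first `n` of the `N` samples
(the coordinates `i < n`) have been observed. -/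
def sampleFiltration (X : Type*) [MeasurableSpace X] (N : ℕ) :
    Filtration ℕ (MeasurableSpace.pi : MeasurableSpace (Fin N → X)) where
  seq n := ⨆ i : Fin N, ⨆ _ : i.val < n,
    MeasurableSpace.comap (fun x : Fin N → X => x i) inferInstance
  mono' := fun _ _ hmn => iSup_mono fun _ =>
    iSup_mono' fun hi => ⟨lt_of_lt_of_le hi hmn, le_rfl⟩
  le' := fun _ => iSup_le fun i => iSup_le fun _ => (measurable_pi_apply i).comap_le

/-- An opportunistic detection rule with maximum sample size `N`: a stopping time `τ` of the
sample filtration with values in `{1, …, N}`, and a terminal decision rule `D`, where `true`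
stands for the alternative hypothesis and `false` for the null hypothesis. If `τ < N` the decision
is the alternative; if `τ = N` the decision is `D`. -/
structure ODR (X : Type*) [MeasurableSpace X] (N : ℕ) where
  τ : (Fin N → X) → ℕ
  isStoppingTime : IsStoppingTime (sampleFiltration X N) (fun x => (τ x : WithTop ℕ))
  one_le : ∀ x, 1 ≤ τ x
  le_max : ∀ x, τ x ≤ N
  D : (Fin N → X) → Bool
  measurable_D : Measurable D

namespace ODR

variable {X : Type*} [MeasurableSpace X] {N : ℕ}

/-- The event that the alternative hypothesis is decided. -/
def decideAlt (φ : ODR X N) : Set (Fin N → X) :=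
  {x | φ.τ x < N} ∪ {x | φ.τ x = N ∧ φ.D x = true}

/-- The event that the null hypothesis is decided. -/
def decideNull (φ : ODR X N) : Set (Fin N → X) :=
  {x | φ.τ x = N ∧ φ.D x = false}

/-- The false alarm probability, for i.i.d. samples with null distribution `p₀`. -/
noncomputable def falseAlarmProb (φ : ODR X N) (p₀ : Measure X) : ℝ≥0∞ :=
  Measure.pi (fun _ : Fin N => p₀) φ.decideAlt

/-- The miss probability, for i.i.d. samples with alternative distribution `p₁`. -/
noncomputable def missProb (φ : ODR X N) (p₁ : Measure X) : ℝ≥0∞ :=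
  Measure.pi (fun _ : Fin N => p₁) φ.decideNull

/-- The expected stopping time under the alternative distribution `p₁`. (`τ` is measurable and
bounded, so the integral is a genuine one for every probability measure `p₁`.) -/
noncomputable def expectedStoppingTime (φ : ODR X N) (p₁ : Measure X) : ℝ :=
  ∫ x, (φ.τ x : ℝ) ∂(Measure.pi fun _ : Fin N => p₁)

/-- The normalized false alarm exponent `(-log P_FA) / N`, as an extended real number, with value
`⊤` if the false alarm probability vanishes (and `N ≥ 1`). -/
noncomputable def falseAlarmExponent (φ : ODR X N) (p₀ : Measure X) : EReal :=
  -ENNReal.log (φ.falseAlarmProb p₀) / ((N : ℝ) : EReal)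

end ODR

/-! ### Change of measure on the sample filtration -/

section ChangeOfMeasure

variable {X : Type*} [MeasurableSpace X] {N : ℕ}

/-! Write `d` for the divergence. On an event known at time `n`, the density of `p₁` against `p₀` is
the exponential of the log-likelihood sum. By the strong law, with `p₁`-probability tending to one,
these sums stay within `ε * N` of `n * d` for all `n ≤ N` at once (`tendsto_pi_deviationSet`).

Converse: with `p₁`-probability bounded below, the alternative is decided at some `τ ≤ c * N` with
`c` at most slightly above `η`. For `η < 1` this is Markov's inequality, for `η = 1` the miss
constraint. There the likelihood ratio at `τ` is at most about `exp (N * η * d)`, so the false alarm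
probability is at least a constant times `exp (-N * η * d)`, up to `exp (-ε * N)`. This bounds the
limsup of the exponent, so it also gives the upper half of the achievability limit.

Achievability: one likelihood ratio test at time `k ≈ η * N` with threshold `k * d - ε_N * N`, where
`ε_N → 0` slowly. Stop if it passes, otherwise wait until `N` and decide the null. Under `p₁` it
passes with probability tending to one, while `pi_llrTest_le` bounds the false alarms. -/

lemma exists_preimage_restrict_of_measurableSet_sampleFiltration {n : ℕ} {E : Set (Fin N → X)}
    (hE : MeasurableSet[sampleFiltration X N n] E) :
    ∃ B : Set ({i : Fin N | i.val < n} → X), MeasurableSet B ∧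
      Set.domRestrict {i : Fin N | i.val < n} ⁻¹' B = E := by
  have hle : sampleFiltration X N n ≤ MeasurableSpace.comap
      (Set.domRestrict (π := fun _ => X) {i : Fin N | i.val < n}) MeasurableSpace.pi := by
    refine iSup_le fun i => iSup_le fun hi => ?_
    have : (fun x : Fin N → X => x i) =
        (fun y : {i : Fin N | i.val < n} → X => y ⟨i, hi⟩) ∘ Set.domRestrict _ := rfl
    rw [this, ← MeasurableSpace.comap_comp]
    exact MeasurableSpace.comap_mono (measurable_pi_apply _).comap_le
  exact hle _ hE

lemma pi_apply_eq_of_measurableSet_sampleFiltration {n : ℕ} {E : Set (Fin N → X)}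
    (hE : MeasurableSet[sampleFiltration X N n] E) (μ ν : Fin N → Measure X)
    [∀ i, IsProbabilityMeasure (μ i)] [∀ i, IsProbabilityMeasure (ν i)]
    (h : ∀ i : Fin N, i.val < n → μ i = ν i) :
    Measure.pi μ E = Measure.pi ν E := by
  obtain ⟨B, hB, rfl⟩ := exists_preimage_restrict_of_measurableSet_sampleFiltration hE
  have hm : Measurable (Set.domRestrict (π := fun _ => X) {i : Fin N | i.val < n}) :=
    measurable_pi_lambda _ fun i => measurable_pi_apply _
  rw [← Measure.map_apply hm hB, ← Measure.map_apply hm hB, ← Measure.infinitePi_eq_pi,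
    ← Measure.infinitePi_eq_pi, Measure.infinitePi_map_restrict', Measure.infinitePi_map_restrict']
  congr 2
  funext i
  exact h i i.2

/-- It suffices to compare on boxes, where the integrand is a product of functions of independent
coordinates. -/
lemma pi_withDensity_eq {ι : Type*} [Fintype ι] (μ : Measure X) [IsProbabilityMeasure μ]
    (f : ι → X → ℝ≥0∞) (hf : ∀ i, Measurable (f i))
    [∀ i, SigmaFinite (μ.withDensity (f i))] :
    Measure.pi (fun i => μ.withDensity (f i)) =
      (Measure.pi fun _ => μ).withDensity fun x => ∏ i, f i (x i) := by
  refine Measure.pi_eq fun s hs => ?_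
  have hmeas (i : ι) : Measurable ((s i).indicator (f i)) := (hf i).indicator (hs i)
  rw [withDensity_apply _ (MeasurableSet.univ_pi hs),
    ← lintegral_indicator (MeasurableSet.univ_pi hs)]
  have hind : (Set.univ.pi s).indicator (fun x : ι → X => ∏ i, f i (x i)) =
      fun x => ∏ i, (s i).indicator (f i) (x i) := by
    funext x
    by_cases hx : x ∈ Set.univ.pi s
    · rw [Set.indicator_of_mem hx]
      exact Finset.prod_congr rfl fun i _ => (Set.indicator_of_mem (hx i trivial) _).symm
    · rw [Set.indicator_of_notMem hx]
      simp only [Set.mem_univ_pi, not_forall] at hx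
      obtain ⟨i, hi⟩ := hx
      exact (Finset.prod_eq_zero (Finset.mem_univ i) (Set.indicator_of_notMem hi _)).symm
  rw [hind, ProbabilityTheory.lintegral_prod_eq_prod_lintegral_of_indepFun Finset.univ
    (fun i (x : ι → X) => (s i).indicator (f i) (x i))
    (ProbabilityTheory.iIndepFun_pi fun i => (hmeas i).aemeasurable)
    fun i => (hmeas i).comp (measurable_pi_apply i)]
  refine Finset.prod_congr rfl fun i _ => ?_
  rw [withDensity_apply _ (hs i), ← lintegral_indicator (hs i),
    (measurePreserving_eval (fun _ : ι => μ) i).lintegral_comp (hmeas i)]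

variable (p₀ p₁ : Measure X)

/-- The log-likelihood ratio of the first `n` of the `N` samples. -/
noncomputable def llrSum (n : ℕ) (x : Fin N → X) : ℝ :=
  ∑ i : Fin N with i.val < n, llr p₁ p₀ (x i)

lemma measurable_apply_sampleFiltration {n : ℕ} {i : Fin N} (hi : i.val < n) :
    Measurable[sampleFiltration X N n] (fun x : Fin N → X => x i) :=
  Measurable.of_comap_le (le_iSup₂_of_le i hi le_rfl)

lemma measurable_llrSum (n : ℕ) :
    Measurable[sampleFiltration X N n] (llrSum p₀ p₁ n : (Fin N → X) → ℝ) := by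
  refine Finset.measurable_fun_sum _ fun i hi => ?_
  exact (measurable_llr p₁ p₀).comp
    (measurable_apply_sampleFiltration (by simpa using hi))

lemma ofReal_exp_llrSum (n : ℕ) (x : Fin N → X) :
    ENNReal.ofReal (Real.exp (llrSum p₀ p₁ n x)) =
      ∏ i : Fin N with i.val < n, ENNReal.ofReal (Real.exp (llr p₁ p₀ (x i))) := by
  rw [llrSum, Real.exp_sum, ENNReal.ofReal_prod_of_nonneg fun _ _ => (Real.exp_pos _).le]

lemma ofReal_exp_llr_of_ne {x : X} (h0 : p₁.rnDeriv p₀ x ≠ 0) (htop : p₁.rnDeriv p₀ x ≠ ∞) :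
    ENNReal.ofReal (Real.exp (llr p₁ p₀ x)) = p₁.rnDeriv p₀ x := by
  rw [llr, Real.exp_log (ENNReal.toReal_pos h0 htop), ENNReal.ofReal_toReal htop]

/-- Since `Real.log 0 = 0`, `llr` vanishes where the density does, so its exponential is 1 there and
only this inequality survives. -/
lemma rnDeriv_le_ofReal_exp_llr {x : X} (htop : p₁.rnDeriv p₀ x ≠ ∞) :
    p₁.rnDeriv p₀ x ≤ ENNReal.ofReal (Real.exp (llr p₁ p₀ x)) := by
  by_cases h0 : p₁.rnDeriv p₀ x = 0
  · simp [h0]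
  · exact (ofReal_exp_llr_of_ne p₀ p₁ h0 htop).ge

variable [IsProbabilityMeasure p₀] [IsProbabilityMeasure p₁]

lemma pi_apply_eq_setLIntegral_prod_rnDeriv (hac : p₁ ≪ p₀) {n : ℕ} {E : Set (Fin N → X)}
    (hE : MeasurableSet[sampleFiltration X N n] E) :
    Measure.pi (fun _ : Fin N => p₁) E =
      ∫⁻ x in E, ∏ i : Fin N with i.val < n, p₁.rnDeriv p₀ (x i)
        ∂Measure.pi fun _ : Fin N => p₀ := by
  -- Since `E` ignores the later samples, their law may be switched from `p₁` to `p₀`; the hybrid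
  -- product has only `n` density factors.
  let f : Fin N → X → ℝ≥0∞ := fun i => if i.val < n then p₁.rnDeriv p₀ else 1
  have hq (i : Fin N) : p₀.withDensity (f i) = if i.val < n then p₁ else p₀ := by
    simp only [f]
    split_ifs
    · exact Measure.withDensity_rnDeriv_eq _ _ hac
    · exact withDensity_one
  have hprob (i : Fin N) : IsProbabilityMeasure (p₀.withDensity (f i)) := by
    rw [hq]; split_ifs <;> infer_instance
  have hf (i : Fin N) : Measurable (f i) := by
    simp only [f]
    split_ifs
    · exact Measure.measurable_rnDeriv _ _
    · exact measurable_const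
  rw [pi_apply_eq_of_measurableSet_sampleFiltration hE _ (fun i => p₀.withDensity (f i))
    fun i hi => by rw [hq, if_pos hi], pi_withDensity_eq p₀ f hf,
    withDensity_apply _ ((sampleFiltration X N).le n _ hE)]
  refine lintegral_congr fun x => ?_
  rw [Finset.prod_filter]
  refine Finset.prod_congr rfl fun i _ => ?_
  simp only [f]
  split_ifs <;> rfl

lemma ae_pi_forall {ι : Type*} [Fintype ι] (μ : Measure X) [IsProbabilityMeasure μ] {p : X → Prop}
    (h : ∀ᵐ x ∂μ, p x) : ∀ᵐ x ∂Measure.pi (fun _ : ι => μ), ∀ i, p (x i) :=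
  ae_all_iff.2 fun i => (Measure.quasiMeasurePreserving_eval (fun _ : ι => μ) i).ae h

lemma pi_le_exp_mul_pi (hac : p₁ ≪ p₀) {n : ℕ} {E : Set (Fin N → X)}
    (hE : MeasurableSet[sampleFiltration X N n] E) {b : ℝ}
    (hb : ∀ x ∈ E, llrSum p₀ p₁ n x ≤ b) :
    Measure.pi (fun _ : Fin N => p₁) E ≤
      ENNReal.ofReal (Real.exp b) * Measure.pi (fun _ : Fin N => p₀) E := by
  rw [pi_apply_eq_setLIntegral_prod_rnDeriv p₀ p₁ hac hE, ← setLIntegral_const]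
  refine setLIntegral_mono_ae' ((sampleFiltration X N).le n _ hE) ?_
  filter_upwards [ae_pi_forall (ι := Fin N) p₀ (p₁.rnDeriv_ne_top p₀)] with x hx hxE
  calc _ ≤ ∏ i : Fin N with i.val < n, ENNReal.ofReal (Real.exp (llr p₁ p₀ (x i))) :=
        Finset.prod_le_prod' fun i _ => rnDeriv_le_ofReal_exp_llr p₀ p₁ (hx i)
    _ = ENNReal.ofReal (Real.exp (llrSum p₀ p₁ n x)) := (ofReal_exp_llrSum p₀ p₁ n x).symm
    _ ≤ _ := ENNReal.ofReal_le_ofReal (Real.exp_le_exp.2 (hb x hxE))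

/-- Unlike the upper bound, this direction needs positive densities, because of the junk value of
`llr` where the density vanishes. -/
lemma exp_mul_pi_le_pi (hac : p₁ ≪ p₀) {n : ℕ} {E : Set (Fin N → X)}
    (hE : MeasurableSet[sampleFiltration X N n] E) {b : ℝ}
    (hb : ∀ x ∈ E, b ≤ llrSum p₀ p₁ n x)
    (hpos : ∀ x ∈ E, ∀ i : Fin N, i.val < n → p₁.rnDeriv p₀ (x i) ≠ 0) :
    ENNReal.ofReal (Real.exp b) * Measure.pi (fun _ : Fin N => p₀) E ≤
      Measure.pi (fun _ : Fin N => p₁) E := by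
  rw [pi_apply_eq_setLIntegral_prod_rnDeriv p₀ p₁ hac hE, ← setLIntegral_const]
  refine setLIntegral_mono_ae' ((sampleFiltration X N).le n _ hE) ?_
  filter_upwards [ae_pi_forall (ι := Fin N) p₀ (p₁.rnDeriv_ne_top p₀)] with x hx hxE
  calc _ ≤ ENNReal.ofReal (Real.exp (llrSum p₀ p₁ n x)) :=
        ENNReal.ofReal_le_ofReal (Real.exp_le_exp.2 (hb x hxE))
    _ = ∏ i : Fin N with i.val < n, ENNReal.ofReal (Real.exp (llr p₁ p₀ (x i))) :=
        ofReal_exp_llrSum p₀ p₁ n x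
    _ = _ := Finset.prod_congr rfl fun i hi =>
        ofReal_exp_llr_of_ne p₀ p₁ (hpos x hxE i (by simpa using hi)) (hx i)

end ChangeOfMeasure

/-! ### Uniform law of large numbers and diagonal choice of the tolerance -/

section LawOfLargeNumbers

/-- Beyond some `M` the ratio is below `ε`; the finitely many earlier terms are bounded and hence
eventually below `ε * N`. -/
lemma eventually_forall_le_abs_le_mul {a : ℕ → ℝ}
    (ha : Tendsto (fun n : ℕ => a n / n) atTop (𝓝 0)) (h0 : a 0 = 0) {ε : ℝ} (hε : 0 < ε) :
    ∀ᶠ N : ℕ in atTop, ∀ n ≤ N, |a n| ≤ ε * N := by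
  obtain ⟨M, hM⟩ := eventually_atTop.1 (ha.eventually (Metric.ball_mem_nhds 0 hε))
  have hC : ∀ᶠ N : ℕ in atTop, ∀ n ∈ Finset.range M, |a n| ≤ ε * N :=
    (Finset.eventually_all _).2 fun n _ =>
      (tendsto_natCast_atTop_atTop.const_mul_atTop hε).eventually_ge_atTop _
  filter_upwards [hC] with N hN n hnN
  rcases lt_or_ge n M with h | h
  · exact hN n (Finset.mem_range.2 h)
  rcases n.eq_zero_or_pos with rfl | hn
  · rw [h0, abs_zero]; positivity
  have hn' : (0 : ℝ) < n := Nat.cast_pos.2 hn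
  have := hM n h
  rw [dist_zero_right, Real.norm_eq_abs, abs_div, Nat.abs_cast,
    div_lt_iff₀ hn'] at this
  exact this.le.trans (by gcongr)

variable {X : Type*} [MeasurableSpace X]

/-- The event that some partial sum of `f` over at most `N` samples deviates from its mean by more
than `ε * N`. -/
def deviationSet (f : X → ℝ) (c ε : ℝ) (N : ℕ) : Set (Fin N → X) :=
  {x | ∃ n ≤ N, ε * N < |∑ i : Fin N with i.val < n, f (x i) - n * c|}

lemma measurableSet_deviationSet {f : X → ℝ} (hf : Measurable f) (c ε : ℝ) (N : ℕ) :
    MeasurableSet (deviationSet f c ε N) := by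
  have : deviationSet f c ε N = ⋃ n ∈ Finset.range (N + 1),
      {x | ε * N < |∑ i : Fin N with i.val < n, f (x i) - n * c|} := by
    ext x; simp [deviationSet]
  rw [this]
  refine Finset.measurableSet_biUnion _ fun n _ => measurableSet_lt measurable_const ?_
  have : Measurable fun x : Fin N → X => ∑ i : Fin N with i.val < n, f (x i) :=
    Finset.measurable_fun_sum _ fun i _ => hf.comp (measurable_pi_apply i)
  exact (this.sub measurable_const).abs

/-- Puts the sample spaces for all `N` on one probability space, where almost sure statements make
sense. -/
lemma map_infinitePi_fin (μ : Measure X) [IsProbabilityMeasure μ] (N : ℕ) :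
    (Measure.infinitePi fun _ : ℕ => μ).map (fun ω (i : Fin N) => ω i) =
      Measure.pi fun _ : Fin N => μ := by
  refine (Measure.pi_eq fun s hs => ?_).symm
  have hr : Measurable fun (ω : ℕ → X) (i : Fin N) => ω i :=
    measurable_pi_lambda _ fun i => measurable_pi_apply _
  rw [Measure.map_apply hr (MeasurableSet.univ_pi hs)]
  let t : ℕ → Set X := fun j => if h : j < N then s ⟨j, h⟩ else Set.univ
  have ht (j : ℕ) : MeasurableSet (t j) := by
    simp only [t]; split_ifs
    · exact hs _
    · exact MeasurableSet.univ
  have : (fun (ω : ℕ → X) (i : Fin N) => ω i) ⁻¹' Set.univ.pi s =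
      Set.pi (Finset.range N : Set ℕ) t := by
    ext ω
    simp only [Set.mem_preimage, Set.mem_pi, Finset.coe_range, Set.mem_Iio, t]
    exact ⟨fun h j hj => by simpa [hj] using h ⟨j, hj⟩,
      fun h i => by simpa using h i i.2⟩
  rw [this, Measure.infinitePi_pi _ fun i _ => ht i, Finset.prod_range]
  simp [t]

lemma tendsto_pi_deviationSet (μ : Measure X) [IsProbabilityMeasure μ] {f : X → ℝ}
    (hf : Measurable f) (hint : Integrable f μ) {ε : ℝ} (hε : 0 < ε) :
    Tendsto (fun N : ℕ => Measure.pi (fun _ : Fin N => μ) (deviationSet f (∫ x, f x ∂μ) ε N))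
      atTop (𝓝 0) := by
  set c := ∫ x, f x ∂μ
  let P := Measure.infinitePi fun _ : ℕ => μ
  have hmp (i : ℕ) : MeasurePreserving (fun ω : ℕ → X => ω i) P μ :=
    measurePreserving_eval_infinitePi (fun _ : ℕ => μ) i
  have hslln : ∀ᵐ ω ∂P, Tendsto (fun n : ℕ => (∑ i ∈ Finset.range n, f (ω i)) / n) atTop (𝓝 c) := by
    have h := ProbabilityTheory.strong_law_ae_real (μ := P) (fun i ω => f (ω i))
      ((hmp 0).integrable_comp_of_integrable hint)
      (fun i j hij => (ProbabilityTheory.iIndepFun_infinitePi (P := fun _ : ℕ => μ)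
        (X := fun _ => f) fun _ => hf).indepFun hij)
      (fun i => ⟨(hf.comp (measurable_pi_apply i)).aemeasurable,
        (hf.comp (measurable_pi_apply 0)).aemeasurable, by
          rw [← Function.comp_def f, ← Function.comp_def f,
            ← Measure.map_map hf (measurable_pi_apply i), ← Measure.map_map hf
              (measurable_pi_apply 0), (hmp i).map_eq, (hmp 0).map_eq]⟩)
    have hc : ∫ ω, f (ω 0) ∂P = c := by
      have := integral_map (μ := P) (measurable_pi_apply (0 : ℕ)).aemeasurable
        hf.aestronglyMeasurable
      rw [(hmp 0).map_eq] at this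
      exact this.symm
    rwa [hc] at h
  let B : ℕ → Set (ℕ → X) := fun N => (fun ω (i : Fin N) => ω i) ⁻¹' deviationSet f c ε N
  have hr (N : ℕ) : Measurable fun (ω : ℕ → X) (i : Fin N) => ω i :=
    measurable_pi_lambda _ fun i => measurable_pi_apply _
  have hBmeas (N : ℕ) : MeasurableSet (B N) := hr N (measurableSet_deviationSet hf c ε N)
  -- Almost every path eventually leaves the deviation events, so their indicators tend to zero and
  -- so do their probabilities.
  have hB : ∀ᵐ ω ∂P, ∀ᶠ N in atTop, ω ∉ B N := by
    filter_upwards [hslln] with ω hω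
    have h0 : Tendsto (fun n : ℕ => (∑ i ∈ Finset.range n, f (ω i) - n * c) / n) atTop (𝓝 0) := by
      have := hω.sub_const c
      rw [sub_self] at this
      refine this.congr' ?_
      filter_upwards [eventually_gt_atTop 0] with n hn
      have : (n : ℝ) ≠ 0 := Nat.cast_ne_zero.2 hn.ne'
      field_simp
    filter_upwards [eventually_forall_le_abs_le_mul h0 (by simp) hε] with N hN
    rintro ⟨n, hn, h⟩
    refine h.not_ge (le_of_eq_of_le ?_ (hN n hn))
    congr 2
    have : Finset.range n = (Finset.univ.filter fun i : Fin N => i.val < n).map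
          Fin.valEmbedding := by
        ext j
        simp only [Finset.mem_range, Finset.mem_map, Finset.mem_filter, Finset.mem_univ, true_and,
          Fin.valEmbedding_apply]
        exact ⟨fun hj => ⟨⟨j, hj.trans_le hn⟩, hj, rfl⟩, by rintro ⟨i, hi, rfl⟩; exact hi⟩
    rw [this, Finset.sum_map]; rfl
  have hlim := tendsto_measure_of_ae_tendsto_indicator_of_isFiniteMeasure (μ := P) (A := ∅) atTop
    MeasurableSet.empty hBmeas (by
      filter_upwards [hB] with ω hω
      filter_upwards [hω] with N hN
      simp [hN])
  rw [measure_empty] at hlim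
  refine hlim.congr fun N => ?_
  rw [← map_infinitePi_fin μ N, Measure.map_apply (hr N) (measurableSet_deviationSet hf c ε N)]

/-- If `f m` tends to `0` for every `m`, then `f (m N) N` still does so for some `m` tending to
infinity. -/
lemma exists_tendsto_atTop_diagonal {f : ℕ → ℕ → ℝ≥0∞}
    (hf : ∀ m, Tendsto (f m) atTop (𝓝 0)) :
    ∃ m : ℕ → ℕ, Tendsto m atTop atTop ∧ Tendsto (fun N => f (m N) N) atTop (𝓝 0) := by
  classical
  let P : ℕ → ℕ → Prop := fun N m => f m N ≤ ((m : ℝ≥0∞) + 1)⁻¹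
  have hP (m : ℕ) : ∀ᶠ N in atTop, P N m :=
    (hf m).eventually_le_const (by simp)
  have hm : Tendsto (fun N => Nat.findGreatest (P N) N) atTop atTop := by
    refine tendsto_atTop.2 fun M => ?_
    filter_upwards [hP M, eventually_ge_atTop M] with N h1 h2
    exact Nat.le_findGreatest h2 h1
  refine ⟨_, hm, ?_⟩
  have hinv : Tendsto (fun m : ℕ => ((m : ℝ≥0∞) + 1)⁻¹) atTop (𝓝 0) := by
    simpa using (tendsto_add_atTop_iff_nat 1).2 ENNReal.tendsto_inv_nat_nhds_zero
  refine tendsto_of_tendsto_of_tendsto_of_le_of_le' tendsto_const_nhds (hinv.comp hm)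
    (Eventually.of_forall fun _ => zero_le) ?_
  -- `Nat.findGreatest` also returns 0 when no index qualifies, so its specification needs one valid
  -- index; 0 is valid for large `N`.
  filter_upwards [hP 0] with N h0
  exact Nat.findGreatest_spec (P := P N) (Nat.zero_le N) h0

end LawOfLargeNumbers

/-! ### Measurability and change of measure at the stopping time -/

section Rules

variable {X : Type*} [MeasurableSpace X] {N : ℕ}

lemma sampleFiltration_self : sampleFiltration X N N = MeasurableSpace.pi :=
  le_antisymm ((sampleFiltration X N).le N)
    (iSup_le fun i => le_iSup₂_of_le i i.2 le_rfl)

namespace ODR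

lemma measurableSet_τ_eq (φ : ODR X N) (n : ℕ) :
    MeasurableSet[sampleFiltration X N n] {x | φ.τ x = n} := by
  simpa using φ.isStoppingTime.measurableSet_eq n

lemma measurable_τ (φ : ODR X N) : Measurable φ.τ :=
  measurable_to_countable' fun n =>
    (sampleFiltration X N).le n _ (φ.measurableSet_τ_eq n)

lemma measurableSet_decideNull (φ : ODR X N) : MeasurableSet φ.decideNull :=
  (φ.measurable_τ (measurableSet_singleton N)).inter
    (φ.measurable_D (measurableSet_singleton false))

lemma decideAlt_eq_compl (φ : ODR X N) : φ.decideAlt = φ.decideNullᶜ := by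
  ext x
  have := φ.le_max x
  rcases this.lt_or_eq with h | h <;> cases hD : φ.D x <;>
    simp [decideAlt, decideNull, h, hD, ne_of_lt]

lemma measurableSet_decideAlt (φ : ODR X N) : MeasurableSet φ.decideAlt :=
  φ.decideAlt_eq_compl ▸ φ.measurableSet_decideNull.compl

/-- Stopping before `N` already forces the alternative; `D` matters only at `n = N`, where the
filtration is the full σ-algebra. -/
lemma measurableSet_decideAlt_inter_τ_eq (φ : ODR X N) (n : ℕ) :
    MeasurableSet[sampleFiltration X N n] (φ.decideAlt ∩ {x | φ.τ x = n}) := by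
  rcases lt_trichotomy n N with h | rfl | h
  · have : φ.decideAlt ∩ {x | φ.τ x = n} = {x | φ.τ x = n} :=
      Set.inter_eq_right.2 fun x hx => Or.inl (lt_of_eq_of_lt hx h)
    rw [this]
    exact φ.measurableSet_τ_eq n
  · have h : MeasurableSet[sampleFiltration X n n] φ.decideAlt := by
      rw [sampleFiltration_self]
      exact φ.measurableSet_decideAlt
    exact @MeasurableSet.inter _ (sampleFiltration X n n) _ _ h (φ.measurableSet_τ_eq n)
  · have : φ.decideAlt ∩ {x | φ.τ x = n} = ∅ :=
      Set.eq_empty_of_forall_notMem fun x hx => (h.trans_eq hx.2.symm).not_ge (φ.le_max x)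
    rw [this]
    exact @MeasurableSet.empty _ (sampleFiltration X N n)

lemma falseAlarmExponent_le (φ : ODR X N) (p₀ : Measure X) (hN : 0 < N) {a : ℝ}
    (h : ENNReal.ofReal (Real.exp (-(N * a))) ≤ φ.falseAlarmProb p₀) :
    φ.falseAlarmExponent p₀ ≤ (a : EReal) := by
  have hN' : (0 : ℝ) < N := Nat.cast_pos.2 hN
  rw [falseAlarmExponent, EReal.div_le_iff_le_mul (EReal.coe_pos.2 hN') (EReal.coe_ne_top _),
    EReal.neg_le, ← EReal.coe_mul, ← EReal.coe_neg]
  have := ENNReal.log_le_log h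
  rwa [ENNReal.log_ofReal_of_pos (Real.exp_pos _), Real.log_exp] at this

lemma le_falseAlarmExponent (φ : ODR X N) (p₀ : Measure X) (hN : 0 < N) {a : ℝ}
    (h : φ.falseAlarmProb p₀ ≤ ENNReal.ofReal (Real.exp (-(N * a)))) :
    (a : EReal) ≤ φ.falseAlarmExponent p₀ := by
  have hN' : (0 : ℝ) < N := Nat.cast_pos.2 hN
  rw [falseAlarmExponent, EReal.le_div_iff_mul_le (EReal.coe_pos.2 hN') (EReal.coe_ne_top _),
    EReal.le_neg, ← EReal.coe_mul, ← EReal.coe_neg, mul_comm a]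
  have := ENNReal.log_le_log h
  rwa [ENNReal.log_ofReal_of_pos (Real.exp_pos _), Real.log_exp] at this

variable (p₁ : Measure X) [IsProbabilityMeasure p₁]

lemma real_decideAlt (φ : ODR X N) :
    (Measure.pi fun _ : Fin N => p₁).real φ.decideAlt = 1 - (φ.missProb p₁).toReal := by
  rw [φ.decideAlt_eq_compl, probReal_compl_eq_one_sub φ.measurableSet_decideNull]
  rfl

lemma integrable_τ (φ : ODR X N) :
    Integrable (fun x => (φ.τ x : ℝ)) (Measure.pi fun _ : Fin N => p₁) :=
  Integrable.of_bound (measurable_from_top.comp φ.measurable_τ).aestronglyMeasurable (N : ℝ)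
    (Eventually.of_forall fun x => by simpa using φ.le_max x)

/-- For `c < 1`, stopping no later than `c * N` decides the alternative, and Markov's inequality
bounds the probability of stopping later. -/
lemma one_sub_le_real_decideAlt_inter (φ : ODR X N) (hN : 0 < N) {c : ℝ} (hc : 0 < c)
    (hc1 : c < 1) :
    1 - φ.expectedStoppingTime p₁ / N / c ≤
      (Measure.pi fun _ : Fin N => p₁).real (φ.decideAlt ∩ {x | (φ.τ x : ℝ) ≤ c * N}) := by
  have hN' : (0 : ℝ) < N := Nat.cast_pos.2 hN
  set P := Measure.pi fun _ : Fin N => p₁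
  have hsub : φ.decideAlt ∩ {x | (φ.τ x : ℝ) ≤ c * N} = {x | (φ.τ x : ℝ) ≤ c * N} := by
    refine Set.inter_eq_right.2 fun x hx => Or.inl ?_
    have : (φ.τ x : ℝ) < N := lt_of_le_of_lt hx (by nlinarith)
    exact_mod_cast this
  have hmeas : MeasurableSet {x | (φ.τ x : ℝ) ≤ c * N} :=
    measurableSet_le (measurable_from_top.comp φ.measurable_τ) measurable_const
  have hM := mul_meas_ge_le_integral_of_nonneg (μ := P) (f := fun x => (φ.τ x : ℝ))
    (Eventually.of_forall fun x => Nat.cast_nonneg _) (φ.integrable_τ p₁) (c * N)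
  have hcompl : P.real {x | (φ.τ x : ℝ) ≤ c * N}ᶜ ≤ P.real {x | c * N ≤ (φ.τ x : ℝ)} :=
    measureReal_mono fun x hx => le_of_lt (not_le.1 (show ¬(φ.τ x : ℝ) ≤ c * N from hx))
  rw [probReal_compl_eq_one_sub hmeas] at hcompl
  have hM' : P.real {x | c * N ≤ (φ.τ x : ℝ)} ≤ φ.expectedStoppingTime p₁ / N / c := by
    rw [div_div, le_div_iff₀ (by positivity)]
    calc _ = c * N * P.real {x | c * N ≤ (φ.τ x : ℝ)} := by ring
      _ ≤ _ := hM
  rw [hsub]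
  linarith

/-- Split by the value of `τ`: each piece is known at that time, so the fixed-time bound applies,
and the disjoint pieces sum back to part of the false alarm event. -/
lemma pi_le_exp_mul_falseAlarmProb (p₀ : Measure X) [IsProbabilityMeasure p₀]
    (hac : p₁ ≪ p₀) (φ : ODR X N) (b : ℝ) :
    Measure.pi (fun _ : Fin N => p₁) (φ.decideAlt ∩ {x | llrSum p₀ p₁ (φ.τ x) x ≤ b}) ≤
      ENNReal.ofReal (Real.exp b) * φ.falseAlarmProb p₀ := by
  let E : ℕ → Set (Fin N → X) := fun n =>
    φ.decideAlt ∩ {x | φ.τ x = n} ∩ {x | llrSum p₀ p₁ n x ≤ b}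
  have hE (n : ℕ) : MeasurableSet[sampleFiltration X N n] (E n) :=
    (φ.measurableSet_decideAlt_inter_τ_eq n).inter
      (measurable_llrSum p₀ p₁ n measurableSet_Iic)
  have hcover : φ.decideAlt ∩ {x | llrSum p₀ p₁ (φ.τ x) x ≤ b} ⊆
      ⋃ n ∈ Finset.range (N + 1), E n := fun x hx => by
    simp only [Set.mem_iUnion, Finset.mem_range]
    exact ⟨φ.τ x, Nat.lt_succ_of_le (φ.le_max x), ⟨hx.1, rfl⟩, hx.2⟩
  have hdisj : Set.PairwiseDisjoint (Finset.range (N + 1) : Set ℕ) E :=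
    fun m _ n _ hmn => Set.disjoint_left.2 fun x hm hn => hmn (hm.1.2.symm.trans hn.1.2)
  calc _ ≤ ∑ n ∈ Finset.range (N + 1), Measure.pi (fun _ : Fin N => p₁) (E n) :=
        (measure_mono hcover).trans (measure_biUnion_finset_le _ _)
    _ ≤ ∑ n ∈ Finset.range (N + 1),
        ENNReal.ofReal (Real.exp b) * Measure.pi (fun _ : Fin N => p₀) (E n) :=
      Finset.sum_le_sum fun n _ => pi_le_exp_mul_pi p₀ p₁ hac (hE n) fun x hx => hx.2
    _ = ENNReal.ofReal (Real.exp b) *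
        Measure.pi (fun _ : Fin N => p₀) (⋃ n ∈ Finset.range (N + 1), E n) := by
      rw [← Finset.mul_sum, measure_biUnion_finset hdisj
        fun n _ => (sampleFiltration X N).le n _ (hE n)]
    _ ≤ _ := by
      gcongr
      exact measure_mono (Set.iUnion₂_subset fun n _ x hx => hx.1.1)

end ODR

end Rules

/-! ### Converse -/

section Converse

variable {X : Type*} [MeasurableSpace X] {p₀ p₁ : Measure X}
  [IsProbabilityMeasure p₀] [IsProbabilityMeasure p₁]

lemma toReal_klDiv_eq_integral_llr (hac : p₁ ≪ p₀) :
    (InformationTheory.klDiv p₁ p₀).toReal = ∫ x, llr p₁ p₀ x ∂p₁ :=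
  InformationTheory.toReal_klDiv_of_measure_eq hac (by simp)

lemma tendsto_natCast_pnat : Tendsto (fun N : ℕ+ => (N : ℕ)) atTop atTop :=
  tendsto_PNat_val_atTop_atTop

/-- With probability bounded away from zero, the alternative is decided not much later than at the
normalized expected stopping time. -/
lemma exists_le_real_decideAlt_inter (φ : (N : ℕ+) → ODR X N) {PM η : ℝ} (hPM_pos : 0 < PM)
    (hPM_lt : PM < 1) (hη_nonneg : 0 ≤ η) (hη_le : η ≤ 1)
    (hmiss : ∀ᶠ N : ℕ+ in atTop, (φ N).missProb p₁ ≤ ENNReal.ofReal PM)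
    (hT : Tendsto (fun N : ℕ+ => (φ N).expectedStoppingTime p₁ / (N : ℝ)) atTop (𝓝 η))
    {δ : ℝ} (hδ : 0 < δ) :
    ∃ κ > 0, ∃ c ≤ η + δ, ∀ᶠ N : ℕ+ in atTop,
      κ ≤ (Measure.pi fun _ : Fin N => p₁).real
        ((φ N).decideAlt ∩ {x | ((φ N).τ x : ℝ) ≤ c * ((N : ℕ) : ℝ)}) := by
  rcases hη_le.lt_or_eq with hη | rfl
  -- `c > η` makes the Markov bound `1 - η / c` positive, and `c < 1` makes stopping by `c * N` an
  -- early stop, hence a decision for the alternative.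
  · obtain ⟨c, hc1, hc2⟩ := exists_between (lt_min hη (lt_add_of_pos_right η hδ))
    have hc0 : 0 < c := hη_nonneg.trans_lt hc1
    have hlim := (hT.div_const c).const_sub 1
    have hpos : 0 < 1 - η / c := by rw [sub_pos, div_lt_one hc0]; exact hc1
    refine ⟨(1 - η / c) / 2, half_pos hpos, c, (hc2.trans_le (min_le_right _ _)).le, ?_⟩
    filter_upwards [hlim.eventually_const_le (half_lt_self hpos)] with N hN
    exact hN.trans ((φ N).one_sub_le_real_decideAlt_inter p₁ N.pos hc0
      (hc2.trans_le (min_le_left _ _)))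
  -- For `η = 1` there is no room for `η < c < 1`; instead `τ ≤ N` always holds and the miss
  -- constraint supplies the probability.
  · refine ⟨1 - PM, sub_pos.2 hPM_lt, 1, by linarith, ?_⟩
    filter_upwards [hmiss] with N hN
    have hset : (φ N).decideAlt ∩ {x | ((φ N).τ x : ℝ) ≤ 1 * ((N : ℕ) : ℝ)} = (φ N).decideAlt :=
      Set.inter_eq_left.2 fun x _ => by simpa using (φ N).le_max x
    rw [hset, (φ N).real_decideAlt p₁]
    have := ENNReal.toReal_le_of_le_ofReal hPM_pos.le hN
    linarith

/-- The slack `ε` is spent in thirds: on `c` exceeding `η`, on the deviation of the log-likelihood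
sums, and on absorbing the constant `κ / 2`. -/
theorem eventually_falseAlarmExponent_le (hD : InformationTheory.klDiv p₁ p₀ ≠ ∞)
    (φ : (N : ℕ+) → ODR X N) {PM η : ℝ} (hPM_pos : 0 < PM) (hPM_lt : PM < 1)
    (hη_nonneg : 0 ≤ η) (hη_le : η ≤ 1)
    (hmiss : ∀ᶠ N : ℕ+ in atTop, (φ N).missProb p₁ ≤ ENNReal.ofReal PM)
    (hT : Tendsto (fun N : ℕ+ => (φ N).expectedStoppingTime p₁ / (N : ℝ)) atTop (𝓝 η))
    {ε : ℝ} (hε : 0 < ε) :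
    ∀ᶠ N : ℕ+ in atTop, (φ N).falseAlarmExponent p₀ ≤
      ((η * (InformationTheory.klDiv p₁ p₀).toReal + ε : ℝ) : EReal) := by
  obtain ⟨hac, hint⟩ := InformationTheory.klDiv_ne_top_iff.1 hD
  set d := (InformationTheory.klDiv p₁ p₀).toReal with hd
  have hd0 : 0 ≤ d := ENNReal.toReal_nonneg
  have hd1 : 0 < d + 1 := by linarith
  obtain ⟨κ, hκ, c, hc, hev⟩ := exists_le_real_decideAlt_inter φ hPM_pos hPM_lt hη_nonneg hη_le
    -- Dividing by `d + 1` rather than `d` covers `d = 0`.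
    hmiss hT (δ := ε / 3 / (d + 1)) (by positivity)
  have hcd : c * d ≤ η * d + ε / 3 := by
    have h1 : ε / 3 / (d + 1) * d ≤ ε / 3 := by
      rw [div_mul_eq_mul_div, div_le_iff₀ hd1]
      nlinarith
    nlinarith [mul_le_mul_of_nonneg_right hc hd0]
  have hdev := (tendsto_pi_deviationSet p₁ (measurable_llr p₁ p₀) hint
    (ε := ε / 3) (by positivity)).comp tendsto_natCast_pnat
  rw [← toReal_klDiv_eq_integral_llr hac] at hdev
  have hexp : Tendsto (fun N : ℕ+ => Real.exp (-(((N : ℕ) : ℝ) * (ε / 3)))) atTop (𝓝 0) :=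
    Real.tendsto_exp_neg_atTop_nhds_zero.comp ((tendsto_natCast_atTop_atTop.comp
      tendsto_natCast_pnat).atTop_mul_const (by positivity))
  filter_upwards [hev, hdev.eventually_le_const (ENNReal.ofReal_pos.2 (half_pos hκ)),
    hexp.eventually_le_const (half_pos hκ)] with N h1 h2 h3
  set P := Measure.pi fun _ : Fin N => p₁
  set b : ℝ := ((N : ℕ) : ℝ) * (η * d + 2 * ε / 3) with hb
  have hsub : ((φ N).decideAlt ∩ {x | ((φ N).τ x : ℝ) ≤ c * ((N : ℕ) : ℝ)}) \
      deviationSet (llr p₁ p₀) d (ε / 3) N ⊆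
      (φ N).decideAlt ∩ {x | llrSum p₀ p₁ ((φ N).τ x) x ≤ b} := by
    rintro x ⟨⟨hx1, hx2⟩, hx3⟩
    refine ⟨hx1, ?_⟩
    simp only [deviationSet, Set.mem_ofPred_eq, not_exists, not_and, not_lt] at hx2 hx3
    have h := (le_abs_self _).trans (hx3 _ ((φ N).le_max x))
    have h' : ((φ N).τ x : ℝ) * d ≤ c * (N : ℕ) * d := mul_le_mul_of_nonneg_right hx2 hd0
    have hN0 : (0 : ℝ) ≤ (N : ℕ) := Nat.cast_nonneg _
    have h'' := mul_le_mul_of_nonneg_left hcd hN0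
    simp only [Set.mem_ofPred_eq, llrSum]
    rw [hb]
    linarith
  have h2' : P.real (deviationSet (llr p₁ p₀) d (ε / 3) N) ≤ κ / 2 :=
    ENNReal.toReal_le_of_le_ofReal (half_pos hκ).le h2
  have hP : κ / 2 ≤ P.real ((φ N).decideAlt ∩ {x | llrSum p₀ p₁ ((φ N).τ x) x ≤ b}) := by
    have hle := measureReal_mono (μ := P) hsub
    have hdiff := le_measureReal_sdiff (μ := P)
      (s₁ := (φ N).decideAlt ∩ {x | ((φ N).τ x : ℝ) ≤ c * ((N : ℕ) : ℝ)})
      (s₂ := deviationSet (llr p₁ p₀) d (ε / 3) N)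
    linarith
  have hP' := (ENNReal.ofReal_le_ofReal hP).trans_eq (ofReal_measureReal (measure_ne_top _ _))
  refine (φ N).falseAlarmExponent_le p₀ N.pos ?_
  calc ENNReal.ofReal (Real.exp (-(((N : ℕ) : ℝ) * (η * d + ε))))
      ≤ ENNReal.ofReal (Real.exp (-b) * (κ / 2)) := by
        refine ENNReal.ofReal_le_ofReal ?_
        calc _ = Real.exp (-b) * Real.exp (-(((N : ℕ) : ℝ) * (ε / 3))) := by
              rw [← Real.exp_add, hb]; ring_nf
          _ ≤ _ := by gcongr
    _ = ENNReal.ofReal (Real.exp (-b)) * ENNReal.ofReal (κ / 2) :=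
        ENNReal.ofReal_mul (Real.exp_pos _).le
    _ ≤ ENNReal.ofReal (Real.exp (-b)) *
        (ENNReal.ofReal (Real.exp b) * (φ N).falseAlarmProb p₀) := by
        gcongr
        exact hP'.trans ((φ N).pi_le_exp_mul_falseAlarmProb p₁ p₀ hac b)
    _ = (φ N).falseAlarmProb p₀ := by
        rw [← mul_assoc, ← ENNReal.ofReal_mul (Real.exp_pos _).le, ← Real.exp_add]
        simp

end Converse

/-! ### Achievability by a single likelihood ratio test -/

section Achievability

variable {X : Type*} [MeasurableSpace X] {N : ℕ}

open Classical in
/-- The rule that stops at time `k` on the event `A`, which depends on the first `k` samples only,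
and otherwise observes all samples and decides `b`. -/
noncomputable def ODR.ofEvent {k : ℕ} (hk : 1 ≤ k) (hkN : k ≤ N) {A : Set (Fin N → X)}
    (hA : MeasurableSet[sampleFiltration X N k] A) (b : Bool) : ODR X N where
  τ x := if x ∈ A then k else N
  isStoppingTime j := by
    by_cases hkj : k ≤ j
    · by_cases hNj : N ≤ j
      · convert MeasurableSet.univ
        ext x
        by_cases hx : x ∈ A <;> simp [hx, hkj, hNj]
      · convert (sampleFiltration X N).mono hkj _ hA
        ext x
        by_cases hx : x ∈ A <;> simp [hx, hkj, hNj]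
    · have hNj : ¬N ≤ j := fun h => hkj (hkN.trans h)
      convert MeasurableSet.empty
      ext x
      by_cases hx : x ∈ A <;> simp [hx, hkj, hNj]
  one_le x := by split_ifs <;> omega
  le_max x := by split_ifs <;> omega
  D _ := b
  measurable_D := measurable_const

namespace ODR

variable {k : ℕ} (hk : 1 ≤ k) (hkN : k ≤ N) {A : Set (Fin N → X)}
  (hA : MeasurableSet[sampleFiltration X N k] A)

lemma decideNull_ofEvent_true : (ofEvent hk hkN hA true).decideNull = ∅ := by
  ext x; simp [decideNull, ofEvent]

lemma decideNull_ofEvent_false (hlt : k < N) :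
    (ofEvent hk hkN hA false).decideNull = Aᶜ := by
  ext x
  by_cases hx : x ∈ A <;> simp [decideNull, ofEvent, hx, hlt.ne]

lemma falseAlarmProb_ofEvent_false (hlt : k < N) (p₀ : Measure X) :
    (ofEvent hk hkN hA false).falseAlarmProb p₀ = Measure.pi (fun _ : Fin N => p₀) A := by
  rw [falseAlarmProb, decideAlt_eq_compl, decideNull_ofEvent_false hk hkN hA hlt, compl_compl]

lemma expectedStoppingTime_ofEvent (b : Bool) (p₁ : Measure X) [IsProbabilityMeasure p₁] :
    (ofEvent hk hkN hA b).expectedStoppingTime p₁ =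
      N + ((k : ℝ) - N) * (Measure.pi fun _ : Fin N => p₁).real A := by
  have hA' : MeasurableSet A := (sampleFiltration X N).le k _ hA
  have h : (fun x => ((ofEvent hk hkN hA b).τ x : ℝ)) =
      fun x => (N : ℝ) + A.indicator (fun _ => (k : ℝ) - N) x := by
    funext x
    by_cases hx : x ∈ A <;> simp [ofEvent, hx]
  rw [expectedStoppingTime, h, integral_add (integrable_const _)
    ((integrable_const _).indicator hA'), integral_indicator_const _ hA']
  simp [mul_comm]

end ODR

variable (p₀ p₁ : Measure X)

/-- The event that the likelihood of the first `k` samples is positive and their log-likelihood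
ratio is at least `b`. -/
def llrTest (N k : ℕ) (b : ℝ) : Set (Fin N → X) :=
  {x | b ≤ llrSum p₀ p₁ k x} ∩ {x | ∀ i : Fin N, i.val < k → p₁.rnDeriv p₀ (x i) ≠ 0}

lemma measurableSet_llrTest (N k : ℕ) (b : ℝ) :
    MeasurableSet[sampleFiltration X N k] (llrTest p₀ p₁ N k b) := by
  refine MeasurableSet.inter (measurable_llrSum p₀ p₁ k measurableSet_Ici) ?_
  simp only [Set.ofPred_forall]
  refine MeasurableSet.iInter fun i => MeasurableSet.iInter fun hi => ?_
  exact (Measure.measurable_rnDeriv p₁ p₀).comp (measurable_apply_sampleFiltration hi)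
    (measurableSet_singleton (0 : ℝ≥0∞)).compl

variable [IsProbabilityMeasure p₀] [IsProbabilityMeasure p₁]

/-- On the test event `p₁` outweighs `p₀` by the factor `exp b`, and its mass there is at most 1. -/
lemma pi_llrTest_le (hac : p₁ ≪ p₀) (N k : ℕ) (b : ℝ) :
    Measure.pi (fun _ : Fin N => p₀) (llrTest p₀ p₁ N k b) ≤ ENNReal.ofReal (Real.exp (-b)) := by
  have h := exp_mul_pi_le_pi p₀ p₁ hac (measurableSet_llrTest p₀ p₁ N k b)
    (fun x hx => hx.1) (fun x hx => hx.2)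
  calc _ = ENNReal.ofReal (Real.exp (-b)) * (ENNReal.ofReal (Real.exp b) *
        Measure.pi (fun _ : Fin N => p₀) (llrTest p₀ p₁ N k b)) := by
        rw [← mul_assoc, ← ENNReal.ofReal_mul (Real.exp_pos _).le, ← Real.exp_add]
        simp
    _ ≤ ENNReal.ofReal (Real.exp (-b)) * 1 := by gcongr; exact h.trans prob_le_one
    _ = _ := mul_one _

/-- The positivity clause of the test costs nothing, as the density is positive `p₁`-almost
everywhere; failing the threshold is then a deviation at time `k`. -/
lemma pi_compl_llrTest_le (hac : p₁ ≪ p₀) {N k : ℕ} (hkN : k ≤ N) (c ε : ℝ) :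
    Measure.pi (fun _ : Fin N => p₁) (llrTest p₀ p₁ N k (k * c - ε * N))ᶜ ≤
      Measure.pi (fun _ : Fin N => p₁) (deviationSet (llr p₁ p₀) c ε N) := by
  refine measure_mono_ae ?_
  filter_upwards [ae_pi_forall (ι := Fin N) p₁ (Measure.rnDeriv_pos hac)] with x hpos hx
  by_contra hdev
  refine hx ⟨?_, fun i _ => (hpos i).ne'⟩
  have h : |llrSum p₀ p₁ k x - k * c| ≤ ε * N := not_lt.1 fun h => hdev ⟨k, hkN, h⟩
  have := (abs_le.1 h).1
  simp only [Set.mem_ofPred_eq]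
  linarith

lemma tendsto_max_one_ceil_mul_sub_one_div {η : ℝ} (hη : 0 ≤ η) :
    Tendsto (fun N : ℕ => ((max 1 ⌈η * (N - 1 : ℕ)⌉₊ : ℕ) : ℝ) / N) atTop (𝓝 η) := by
  have h1 : Tendsto (fun N : ℕ => (1 : ℝ) / N) atTop (𝓝 0) := tendsto_one_div_atTop_nhds_zero_nat
  have h2 : Tendsto (fun N : ℕ => η - η * (1 / N)) atTop (𝓝 η) := by
    simpa using (h1.const_mul η).const_sub η
  have h3 : Tendsto (fun N : ℕ => η + (1 : ℝ) / N) atTop (𝓝 η) := by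
    simpa using h1.const_add η
  refine tendsto_of_tendsto_of_tendsto_of_le_of_le' h2 h3 ?_ ?_ <;>
    filter_upwards [eventually_gt_atTop 0] with N hN
  · have hN' : (0 : ℝ) < N := Nat.cast_pos.2 hN
    rw [le_div_iff₀ hN', Nat.cast_max]
    refine le_trans (le_of_eq ?_) ((Nat.le_ceil (η * (N - 1 : ℕ))).trans (le_max_right _ _))
    rw [Nat.cast_pred hN]
    field_simp
  · have hN' : (0 : ℝ) < N := Nat.cast_pos.2 hN
    rw [div_le_iff₀ hN', Nat.cast_max]
    have hηN : 0 ≤ η * N := by positivity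
    have hexp : (η + 1 / N) * N = η * N + 1 := by field_simp
    rw [hexp]
    refine max_le (by simpa using hηN) ?_
    refine (Nat.ceil_lt_add_one (by positivity)).le.trans ?_
    rw [Nat.cast_pred hN]
    nlinarith

lemma max_one_ceil_mul_sub_one_lt {η : ℝ} (hη : η ≤ 1) {N : ℕ} (hN : 1 < N) :
    max 1 ⌈η * (N - 1 : ℕ)⌉₊ < N := by
  refine max_lt hN (lt_of_le_of_lt (Nat.ceil_le.2 ?_) (Nat.sub_one_lt (by omega)))
  exact mul_le_of_le_one_left (Nat.cast_nonneg _) hη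

variable {p₀ p₁}

theorem exists_odr_seq (hD : InformationTheory.klDiv p₁ p₀ ≠ ∞) {PM η : ℝ} (hPM_pos : 0 < PM)
    (hη_nonneg : 0 ≤ η) (hη_le : η ≤ 1) :
    ∃ (φ : (N : ℕ+) → ODR X N) (a : ℕ+ → ℝ),
      (∀ N : ℕ+, (φ N).missProb p₁ ≤ ENNReal.ofReal PM) ∧
      Tendsto (fun N : ℕ+ => (φ N).expectedStoppingTime p₁ / (N : ℝ)) atTop (𝓝 η) ∧
      Tendsto a atTop (𝓝 (η * (InformationTheory.klDiv p₁ p₀).toReal)) ∧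
      ∀ᶠ N : ℕ+ in atTop, (a N : EReal) ≤ (φ N).falseAlarmExponent p₀ := by
  classical
  obtain ⟨hac, hint⟩ := InformationTheory.klDiv_ne_top_iff.1 hD
  set d := (InformationTheory.klDiv p₁ p₀).toReal with hd
  -- The tolerance shrinks with `N`, slowly enough that deviations stay unlikely; a fixed tolerance
  -- would lose a constant in the exponent.
  obtain ⟨m, hm, hdev⟩ := exists_tendsto_atTop_diagonal
    (f := fun m N => Measure.pi (fun _ : Fin N => p₁)
      (deviationSet (llr p₁ p₀) d (1 / ((m : ℝ) + 1)) N)) fun m => by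
    rw [hd, toReal_klDiv_eq_integral_llr hac]
    exact tendsto_pi_deviationSet p₁ (measurable_llr p₁ p₀) hint (by positivity)
  let ε : ℕ → ℝ := fun N => 1 / ((m N : ℝ) + 1)
  have hε : Tendsto ε atTop (𝓝 0) := tendsto_one_div_add_atTop_nhds_zero_nat.comp hm
  -- `N - 1` keeps `k < N` for `N > 1` even when `η = 1`, so passing the test is an early stop; the
  -- maximum with 1 handles `η = 0`.
  let k : ℕ → ℕ := fun N => max 1 ⌈η * (N - 1 : ℕ)⌉₊
  have hk1 (N : ℕ) : 1 ≤ k N := le_max_left _ _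
  have hklim : Tendsto (fun N : ℕ => (k N : ℝ) / N) atTop (𝓝 η) :=
    tendsto_max_one_ceil_mul_sub_one_div hη_nonneg
  let A : (N : ℕ) → Set (Fin N → X) := fun N => llrTest p₀ p₁ N (k N) (k N * d - ε N * N)
  have hA (N : ℕ) : MeasurableSet[sampleFiltration X N (k N)] (A N) :=
    measurableSet_llrTest p₀ p₁ N _ _
  have hA' (N : ℕ) : MeasurableSet (A N) := (sampleFiltration X N).le _ _ (hA N)
  have hAcompl : Tendsto (fun N : ℕ => Measure.pi (fun _ : Fin N => p₁) (A N)ᶜ) atTop (𝓝 0) := by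
    refine tendsto_of_tendsto_of_tendsto_of_le_of_le' tendsto_const_nhds hdev
      (Eventually.of_forall fun _ => zero_le) ?_
    filter_upwards [eventually_gt_atTop 1] with N hN
    exact pi_compl_llrTest_le p₀ p₁ hac (max_one_ceil_mul_sub_one_lt hη_le hN).le d (ε N)
  have hAreal : Tendsto (fun N : ℕ => (Measure.pi fun _ : Fin N => p₁).real (A N)) atTop (𝓝 1) := by
    have h := ((ENNReal.tendsto_toReal ENNReal.zero_ne_top).comp hAcompl).const_sub 1
    simp only [ENNReal.toReal_zero, sub_zero] at h
    refine h.congr fun N => ?_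
    have := probReal_compl_eq_one_sub (μ := Measure.pi fun _ : Fin N => p₁) (hA' N)
    simp only [Measure.real] at this
    simp only [Function.comp_apply, this, Measure.real, sub_sub_cancel]
  let good : ℕ → Prop := fun N =>
    k N < N ∧ Measure.pi (fun _ : Fin N => p₁) (A N)ᶜ ≤ ENNReal.ofReal PM
  let φ : (N : ℕ+) → ODR X N := fun N =>
    if h : good N then ODR.ofEvent (hk1 N) h.1.le (hA N) false
    -- For the remaining finitely many `N`, stop at time 1 and always decide the alternative: the
    -- miss probability is zero and the limits are unaffected.
    else ODR.ofEvent le_rfl N.pos MeasurableSet.univ true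
  have hgood : ∀ᶠ N : ℕ+ in atTop, good N := by
    refine tendsto_natCast_pnat.eventually ?_
    filter_upwards [eventually_gt_atTop 1,
      hAcompl.eventually_le_const (ENNReal.ofReal_pos.2 hPM_pos)] with N h1 h2
    exact ⟨max_one_ceil_mul_sub_one_lt hη_le h1, h2⟩
  refine ⟨φ, fun N => k N / (N : ℕ) * d - ε N, fun N => ?_, ?_, ?_, ?_⟩
  · by_cases h : good N
    · simp only [φ, dif_pos h, ODR.missProb, ODR.decideNull_ofEvent_false (hk1 N) _ _ h.1]
      exact h.2
    · simp only [φ, dif_neg h, ODR.missProb, ODR.decideNull_ofEvent_true, measure_empty]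
      exact zero_le
  · have hlim : Tendsto (fun N : ℕ => 1 + ((k N : ℝ) / N - 1) *
        (Measure.pi fun _ : Fin N => p₁).real (A N)) atTop (𝓝 (1 + (η - 1) * 1)) :=
      ((hklim.sub_const 1).mul hAreal).const_add 1
    rw [mul_one, add_sub_cancel] at hlim
    refine (hlim.comp tendsto_natCast_pnat).congr' ?_
    filter_upwards [hgood] with N h
    have hN : ((N : ℕ) : ℝ) ≠ 0 := Nat.cast_ne_zero.2 N.ne_zero
    simp only [φ, dif_pos h, ODR.expectedStoppingTime_ofEvent, Function.comp_apply]
    field_simp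
  · have hlim := (hklim.mul_const d).sub hε
    rw [sub_zero] at hlim
    exact hlim.comp tendsto_natCast_pnat
  · filter_upwards [hgood] with N h
    refine (φ N).le_falseAlarmExponent p₀ N.pos ?_
    simp only [φ, dif_pos h, ODR.falseAlarmProb_ofEvent_false (hk1 N) _ _ h.1]
    refine (pi_llrTest_le p₀ p₁ hac N _ _).trans_eq ?_
    have hN : ((N : ℕ) : ℝ) ≠ 0 := Nat.cast_ne_zero.2 N.ne_zero
    congr 3
    field_simp

end Achievability

/-! ### Main theorem -/

theorem mainTheorem3 {X : Type*} [MeasurableSpace X]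
    (p₀ p₁ : Measure X) [IsProbabilityMeasure p₀] [IsProbabilityMeasure p₁]
    (hD : InformationTheory.klDiv p₁ p₀ ≠ ∞)
    (PM : ℝ) (hPM_pos : 0 < PM) (hPM_lt : PM < 1)
    (η : ℝ) (hη_nonneg : 0 ≤ η) (hη_le : η ≤ 1) :
    (∃ φ : (N : ℕ+) → ODR X N,
      (∀ N : ℕ+, (φ N).missProb p₁ ≤ ENNReal.ofReal PM) ∧
      Tendsto (fun N : ℕ+ => (φ N).expectedStoppingTime p₁ / (N : ℝ)) atTop (𝓝 η) ∧
      Tendsto (fun N : ℕ+ => (φ N).falseAlarmExponent p₀) atTop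
        (𝓝 ((η * (InformationTheory.klDiv p₁ p₀).toReal : ℝ) : EReal))) ∧
    (∀ φ : (N : ℕ+) → ODR X N,
      (∀ᶠ N : ℕ+ in atTop, (φ N).missProb p₁ ≤ ENNReal.ofReal PM) →
      Tendsto (fun N : ℕ+ => (φ N).expectedStoppingTime p₁ / (N : ℝ)) atTop (𝓝 η) →
      liminf (fun N : ℕ+ => (φ N).falseAlarmExponent p₀) atTop ≤
        ((η * (InformationTheory.klDiv p₁ p₀).toReal : ℝ) : EReal)) := by
  -- The converse in its limsup form, used for both halves.
  have hupper (φ : (N : ℕ+) → ODR X N)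
      (hmiss : ∀ᶠ N : ℕ+ in atTop, (φ N).missProb p₁ ≤ ENNReal.ofReal PM)
      (hT : Tendsto (fun N : ℕ+ => (φ N).expectedStoppingTime p₁ / (N : ℝ)) atTop (𝓝 η))
      (b : EReal) (hb : ((η * (InformationTheory.klDiv p₁ p₀).toReal : ℝ) : EReal) < b) :
      ∀ᶠ N : ℕ+ in atTop, (φ N).falseAlarmExponent p₀ < b := by
    obtain ⟨r, hr1, hr2⟩ := EReal.lt_iff_exists_real_btwn.1 hb
    have h := eventually_falseAlarmExponent_le hD φ hPM_pos hPM_lt hη_nonneg hη_le hmiss hT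
      (sub_pos.2 (EReal.coe_lt_coe_iff.1 hr1))
    rw [add_sub_cancel] at h
    exact h.mono fun N hN => hN.trans_lt hr2
  refine ⟨?_, fun φ hmiss hT => ?_⟩
  · obtain ⟨φ, a, hmiss, hT, ha, hle⟩ := exists_odr_seq hD hPM_pos hη_nonneg hη_le
    refine ⟨φ, hmiss, hT, tendsto_order.2 ⟨fun b hb => ?_,
      hupper φ (Eventually.of_forall hmiss) hT⟩⟩
    have ha' := (continuous_coe_real_ereal.tendsto _).comp ha
    filter_upwards [hle, ha'.eventually_const_lt hb] with N h1 h2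
    exact h2.trans_le h1
  · refine le_of_forall_gt_imp_ge_of_dense fun b hb => ?_
    exact liminf_le_of_frequently_le' ((hupper φ hmiss hT b hb).mono fun N hN => hN.le).frequently
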